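/- **Setting.** For an open set $U\subseteq\mathbb R^3$ let $FU=U\times Gl(3,\mathbb R)$ be its frame bundle, with right action $(x,z)\cdot g=(x,zg)$, and let $e_1=(0,\mathrm{Id})\in F\mathbb R^3$. A *principal isomorphism* $\Psi:FU\to FV$ ($U,V\subseteq\mathbb R^3$ open) is a diffeomorphism with $\Psi(X\cdot g)=\Psi(X)\cdot g$ for all $X\in FU$, $g\in Gl(3,\mathbb R)$; it induces $\psi:U\to V$. For the translation $\tau_v$ of $\mathbb R^3$ by $v$, let $F\tau_v(x,z)=(x+v,z)$. The 1-jets $j^1_{X,Y}\Psi$ (with $X\in FU$, $Y=\Psi(X)$) of all principal isomorphisms form $J^1(F\mathbb R^3)$. Let $\tilde J^1(F\mathbb R^3)$ be its quotient by the action $j^1_{X,Y}\Psi\cdot g=j^1_{X\cdot g,Y\cdot g}\Psi$ of $Gl(3,\mathbb R)$, write $j^1_{x,y}\Psi$ for the class of $j^1_{X,Y}\Psi$ with $X$ over $x$ and $Y$ over $y$, and let $\tilde J^1(FU,FV)$ consist of the classes with $x\in U$, $y\in V$. Under composition of jets $\tilde J^1(F\mathbb R^3)$ is a groupoid over $\mathbb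 R^3$. A *Cosserat continuum* consists of a body $B$, identified through a reference configuration with a non-empty open subset of $\mathbb R^3$, and a smooth mechanical response $W:\tilde J^1(FB,FB)\to V$, where $V$ is a real (normed) vector space, which does not depend on the end point: $W(j^1_{x,y}\Psi)=W(j^1_{x,z}(F\tau_{z-y}\circ\Psi))$ for $x,y,z\in B$. By this independence $W$ extends uniquely to $\tilde J^1(FB,F\mathbb R^3)$. A *deformation over* an open set $U\subseteq B$ is a principal isomorphism $\tilde\kappa$ of $FU$ onto $F\kappa(U)$, with $\kappa(U)\subseteq\mathbb R^3$ open and $\kappa$ its induced map; it is *global* if $U=B$. The *material groupoid* $\overline\Omega(B)$ is the set of all $j^1_{x,y}\Psi\in\tilde J^1(FB,FB)$ such that $$W(j^1_{y,\kappa(y)}\tilde\kappa\cdot j^1_{x,y}\Psi)=W(j^1_{y,\kappa(y)}\tilde\kappa)\quad\text{for every global deformation }\tilde\kappa .$$ **Homogeneity.** An open set $U\subseteq B$ is *homogeneous* if there is a deformation $\tilde\kappa$ over $U$ with $$j^1_{x,y}\bigl(\tilde\kappa^{-1}\circ F\tau_{\kappa(y)-\kappa(x)}\circ\tilde\kappa\bigr)\in\overline\Omega(B)\quad\text{for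 all }x,y\in U.$$ The continuum is *homogeneous* if $B$ is homogeneous, and *locally homogeneous* if $B$ is covered by homogeneous open subsets. **Homogeneity with respect to a crystal reference.** A *crystal reference* is a non-holonomic frame of second order of $B$, i.e. a jet $\overline Z_0=j^1_{e_1,Z_0}\Phi$ of a principal isomorphism $\Phi$ with $Z_0=\Phi(e_1)\in FB$. Let $z_0$ be the base point of $Z_0$. It defines the non-holonomic structure of second order $\overline\omega_{\overline Z_0}=\overline\Omega_{z_0}(B)\cdot\overline Z_0$, the set of all composites $j^1_{Z_0,Z}\Psi\cdot\overline Z_0$ where the class of $j^1_{Z_0,Z}\Psi$ lies in $\overline\Omega(B)$. An open set $U\subseteq B$ is *homogeneous with respect to $\overline Z_0$* if there is a deformation $\tilde\kappa$ over $U$ such that the jet at $e_1$ of $\tilde\kappa^{-1}\circ F\tau_{\kappa(x)}$ lies in $\overline\omega_{\overline Z_0}$ for all $x\in U$. The continuum is *homogeneous with respect to $\overline Z_0$* if $B$ is, and *locally homogeneous with respect to $\overline Z_0$* if every point of $B$ has an open neighbourhood in $B$ which is homogeneous with respect to $\overline Z_0$. **Proposition.** Let $B$ be a Cosserat continuum.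 1. $B$ is homogeneous if and only if there is a crystal reference $\overline Z_0$ such that $B$ is homogeneous with respect to $\overline Z_0$. 2. If $B$ is connected, then $B$ is locally homogeneous if and only if there is a crystal reference $\overline Z_0$ such that $B$ is locally homogeneous with respect to $\overline Z_0$. The implication from right to left holds without connectedness. -/

import Mathlib

open scoped ContDiff

/-- Physical space `ℝ³`. -/
abbrev E3 : Type := EuclideanSpace ℝ (Fin 3)

/-- The general linear group `Gl(3, ℝ)`, acting on `ℝ³`. -/
abbrev GL3 : Type := (E3 →L[ℝ] E3)ˣ

/-- The vector space `ℝ³ × End(ℝ³)`, in which the frame bundle `Fℝ³` is an open subset: the pair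
`(x, z)` with `z` invertible is the linear frame `z : ℝ³ → T_x ℝ³ = ℝ³` at the point `x`. -/
abbrev FrameSpace : Type := E3 × (E3 →L[ℝ] E3)

/-- The frame bundle `FU` of a set `U ⊆ ℝ³`. -/
def frameBundle (U : Set E3) : Set FrameSpace := {X | X.1 ∈ U ∧ IsUnit X.2}

/-- The right translation `X ↦ X · g`, i.e. `(x, z) ↦ (x, z ∘ g)`, by `g ∈ Gl(3, ℝ)`. -/
noncomputable def rightAct (g : GL3) : FrameSpace →L[ℝ] FrameSpace :=
  (ContinuousLinearMap.id ℝ E3).prodMap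
    ((ContinuousLinearMap.compL ℝ E3 E3 E3).flip (g : E3 →L[ℝ] E3))

@[simp] theorem rightAct_apply (g : GL3) (X : FrameSpace) :
    rightAct g X = (X.1, X.2 * (g : E3 →L[ℝ] E3)) := rfl

theorem rightAct_rightAct (g h : GL3) (X : FrameSpace) :
    rightAct h (rightAct g X) = rightAct (g * h) X := by
  simp [mul_assoc]

theorem rightAct_one (X : FrameSpace) : rightAct 1 X = X := by simp

theorem rightAct_mem {U : Set E3} (g : GL3) {X : FrameSpace} (hX : X ∈ frameBundle U) :
    rightAct g X ∈ frameBundle U :=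
  ⟨hX.1, hX.2.mul g.isUnit⟩

/-- The frame `e₁ = j¹_{0,0} Id` at the origin. -/
def stdFrame : FrameSpace := (0, 1)

theorem frame_mem {U : Set E3} {x : E3} (hx : x ∈ U) : ((x, 1) : FrameSpace) ∈ frameBundle U :=
  ⟨hx, isUnit_one⟩

theorem rightAct_frame {X : FrameSpace} (u : GL3) (hu : (u : E3 →L[ℝ] E3) = X.2) :
    rightAct u (X.1, 1) = X := by
  simp [hu]

/-- A (smooth, local) isomorphism of principal bundles `Ψ : FU → FV`, with `U, V` open in `ℝ³`,
over the identity of `Gl(3, ℝ)`. The values outside `FU` are irrelevant. -/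
structure FrameIso extends OpenPartialHomeomorph FrameSpace FrameSpace where
  dom : Set E3
  cod : Set E3
  isOpen_dom : IsOpen dom
  isOpen_cod : IsOpen cod
  source_eq : source = frameBundle dom
  target_eq : target = frameBundle cod
  smooth_toFun : ContDiffOn ℝ ∞ toFun source
  smooth_invFun : ContDiffOn ℝ ∞ invFun target
  equivariant : ∀ X ∈ source, ∀ g : GL3, toFun (rightAct g X) = rightAct g (toFun X)

namespace FrameIso

/-- The map `ψ : U → V` on base points induced by `Ψ`. -/
def base (Ψ : FrameIso) (x : E3) : E3 := (Ψ.toFun (x, 1)).1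

theorem base_fst (Ψ : FrameIso) {X : FrameSpace} (hX : X ∈ Ψ.source) :
    (Ψ.toFun X).1 = Ψ.base X.1 := by
  have hX' := hX
  rw [Ψ.source_eq] at hX'
  obtain ⟨u, hu⟩ := hX'.2
  have h1 : ((X.1, 1) : FrameSpace) ∈ Ψ.source := by
    rw [Ψ.source_eq]; exact frame_mem hX'.1
  have h2 := Ψ.equivariant _ h1 u
  rw [rightAct_frame u hu] at h2
  rw [h2]; rfl

theorem base_mem (Ψ : FrameIso) {x : E3} (hx : x ∈ Ψ.dom) : Ψ.base x ∈ Ψ.cod := by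
  have h1 : ((x, 1) : FrameSpace) ∈ Ψ.source := by
    rw [Ψ.source_eq]; exact frame_mem hx
  have h2 := Ψ.map_source h1
  rw [Ψ.target_eq] at h2
  exact h2.1

theorem equivariant_symm (Ψ : FrameIso) (X : FrameSpace) (hX : X ∈ Ψ.target) (g : GL3) :
    Ψ.invFun (rightAct g X) = rightAct g (Ψ.invFun X) := by
  have hs := Ψ.map_target' hX
  have hs' : rightAct g (Ψ.invFun X) ∈ Ψ.source := by
    rw [Ψ.source_eq] at hs ⊢
    exact rightAct_mem g hs
  have h := Ψ.equivariant _ hs g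
  rw [Ψ.right_inv' hX] at h
  rw [← h]
  exact Ψ.left_inv' hs'

/-- The inverse isomorphism `Ψ⁻¹ : FV → FU`. -/
noncomputable def symm (Ψ : FrameIso) : FrameIso where
  toOpenPartialHomeomorph := Ψ.toOpenPartialHomeomorph.symm
  dom := Ψ.cod
  cod := Ψ.dom
  isOpen_dom := Ψ.isOpen_cod
  isOpen_cod := Ψ.isOpen_dom
  source_eq := Ψ.target_eq
  target_eq := Ψ.source_eq
  smooth_toFun := Ψ.smooth_invFun
  smooth_invFun := Ψ.smooth_toFun
  equivariant := Ψ.equivariant_symm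

theorem trans_source_eq (Ψ Φ : FrameIso) :
    (Ψ.toOpenPartialHomeomorph.trans Φ.toOpenPartialHomeomorph).source =
      frameBundle {x | x ∈ Ψ.dom ∧ Ψ.base x ∈ Φ.dom} := by
  ext X
  rw [OpenPartialHomeomorph.trans_source]
  constructor
  · rintro ⟨h1, h2⟩
    have h3 : Ψ.toFun X ∈ Φ.source := h2
    have h4 := Ψ.base_fst h1
    rw [Ψ.source_eq] at h1
    rw [Φ.source_eq] at h3
    exact ⟨⟨h1.1, h4 ▸ h3.1⟩, h1.2⟩
  · rintro ⟨⟨h1, h2⟩, h3⟩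
    have h4 : X ∈ Ψ.source := by rw [Ψ.source_eq]; exact ⟨h1, h3⟩
    have h5 := Ψ.map_source h4
    rw [Ψ.target_eq] at h5
    refine ⟨h4, ?_⟩
    change Ψ.toFun X ∈ Φ.source
    rw [Φ.source_eq]
    exact ⟨by rw [Ψ.base_fst h4]; exact h2, h5.2⟩

theorem isOpen_of_isOpen_frameBundle {U : Set E3} (h : IsOpen (frameBundle U)) : IsOpen U := by
  have hc : Continuous (fun x : E3 => ((x, 1) : FrameSpace)) := by fun_prop
  have : U = (fun x : E3 => ((x, 1) : FrameSpace)) ⁻¹' frameBundle U := by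
    ext x; exact ⟨frame_mem, fun h => h.1⟩
  rw [this]
  exact h.preimage hc

/-- The composite `Φ ∘ Ψ`, defined where it makes sense. -/
noncomputable def trans (Ψ Φ : FrameIso) : FrameIso where
  toOpenPartialHomeomorph := Ψ.toOpenPartialHomeomorph.trans Φ.toOpenPartialHomeomorph
  dom := {x | x ∈ Ψ.dom ∧ Ψ.base x ∈ Φ.dom}
  cod := {x | x ∈ Φ.cod ∧ Φ.symm.base x ∈ Ψ.cod}
  isOpen_dom := isOpen_of_isOpen_frameBundle
    (trans_source_eq Ψ Φ ▸ (Ψ.toOpenPartialHomeomorph.trans Φ.toOpenPartialHomeomorph).open_source)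
  isOpen_cod := isOpen_of_isOpen_frameBundle
    (trans_source_eq Φ.symm Ψ.symm ▸
      (Φ.symm.toOpenPartialHomeomorph.trans Ψ.symm.toOpenPartialHomeomorph).open_source)
  source_eq := trans_source_eq Ψ Φ
  target_eq := trans_source_eq Φ.symm Ψ.symm
  smooth_toFun := Φ.smooth_toFun.comp (Ψ.smooth_toFun.mono (fun _ h => h.1)) (fun _ h => h.2)
  smooth_invFun :=
    Ψ.smooth_invFun.comp (Φ.smooth_invFun.mono (fun _ h => h.1)) (fun _ h => h.2)
  equivariant := by
    intro X hX g
    change Φ.toFun (Ψ.toFun (rightAct g X)) = rightAct g (Φ.toFun (Ψ.toFun X))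
    rw [Ψ.equivariant X hX.1 g]
    exact Φ.equivariant _ hX.2 g

/-- The isomorphism `Fτ_v : (x, z) ↦ (x + v, z)` of `Fℝ³` induced by the translation `τ_v`. -/
noncomputable def translation (v : E3) : FrameIso where
  toFun := fun X => (X.1 + v, X.2)
  invFun := fun X => (X.1 - v, X.2)
  source := frameBundle Set.univ
  target := frameBundle Set.univ
  map_source' := fun _ h => ⟨trivial, h.2⟩
  map_target' := fun _ h => ⟨trivial, h.2⟩
  left_inv' := fun X _ => by simp
  right_inv' := fun X _ => by simp
  open_source := by
    have : frameBundle Set.univ = Prod.snd ⁻¹' {z : E3 →L[ℝ] E3 | IsUnit z} := by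
      ext X; simp [frameBundle]
    rw [this]
    exact Units.isOpen.preimage continuous_snd
  open_target := by
    have : frameBundle Set.univ = Prod.snd ⁻¹' {z : E3 →L[ℝ] E3 | IsUnit z} := by
      ext X; simp [frameBundle]
    rw [this]
    exact Units.isOpen.preimage continuous_snd
  continuousOn_toFun := by fun_prop
  continuousOn_invFun := by fun_prop
  dom := Set.univ
  cod := Set.univ
  isOpen_dom := isOpen_univ
  isOpen_cod := isOpen_univ
  source_eq := rfl
  target_eq := rfl
  smooth_toFun := by fun_prop
  smooth_invFun := by fun_prop
  equivariant := fun _ _ _ => rfl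

theorem differentiableAt (Ψ : FrameIso) {X : FrameSpace} (hX : X ∈ Ψ.source) :
    DifferentiableAt ℝ Ψ.toFun X :=
  (Ψ.smooth_toFun.contDiffAt (Ψ.open_source.mem_nhds hX)).differentiableAt (by simp)

end FrameIso

/-- An element `j¹_{X,Y} Ψ` of `J¹(Fℝ³)`: the 1-jet at a frame `X` (with `Y = Ψ(X)`) of a local
automorphism `Ψ` of the principal bundle `Fℝ³` over the identity of `Gl(3, ℝ)`. A 1-jet is the
triple formed by `X`, `Y` and the tangent map `T_X Ψ`. -/
@[ext] structure FrameJet where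
  src : FrameSpace
  tgt : FrameSpace
  lin : FrameSpace →L[ℝ] FrameSpace
  exists_rep : ∃ Ψ : FrameIso, src ∈ Ψ.source ∧ Ψ.toFun src = tgt ∧ fderiv ℝ Ψ.toFun src = lin

/-- The 1-jet of `Ψ` at the frame `X`. -/
noncomputable def FrameIso.jetAt (Ψ : FrameIso) (X : FrameSpace) (hX : X ∈ Ψ.source) :
    FrameJet where
  src := X
  tgt := Ψ.toFun X
  lin := fderiv ℝ Ψ.toFun X
  exists_rep := ⟨Ψ, hX, rfl, rfl⟩

namespace FrameJet

theorem src_isUnit (a : FrameJet) : IsUnit a.src.2 := by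
  obtain ⟨Ψ, h1, -, -⟩ := a.exists_rep
  rw [Ψ.source_eq] at h1
  exact h1.2

theorem tgt_isUnit (a : FrameJet) : IsUnit a.tgt.2 := by
  obtain ⟨Ψ, h1, h2, -⟩ := a.exists_rep
  have h3 := Ψ.map_source' h1
  rw [h2, Ψ.target_eq] at h3
  exact h3.2

/-- Composition of jets, `j¹_{Y,Z} Φ · j¹_{X,Y} Ψ = j¹_{X,Z} (Φ ∘ Ψ)`. -/
noncomputable def comp (b a : FrameJet) (h : a.tgt = b.src) : FrameJet where
  src := a.src
  tgt := b.tgt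
  lin := b.lin ∘L a.lin
  exists_rep := by
    obtain ⟨Ψ, h1, h2, h3⟩ := a.exists_rep
    obtain ⟨Φ, k1, k2, k3⟩ := b.exists_rep
    rw [← h, ← h2] at k1 k2 k3
    refine ⟨Ψ.trans Φ, ⟨h1, k1⟩, k2, ?_⟩
    rw [← k3, ← h3]
    exact fderiv_comp a.src (Φ.differentiableAt k1) (Ψ.differentiableAt h1)

/-- The right action `(j¹_{X,Y} Ψ, g) ↦ j¹_{X·g,Y·g} Ψ` of `Gl(3, ℝ)` on `J¹(Fℝ³)`. -/
noncomputable def act (a : FrameJet) (g : GL3) : FrameJet where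
  src := rightAct g a.src
  tgt := rightAct g a.tgt
  lin := rightAct g ∘L a.lin ∘L rightAct g⁻¹
  exists_rep := by
    obtain ⟨Ψ, h1, h2, h3⟩ := a.exists_rep
    have hs : rightAct g a.src ∈ Ψ.source := by
      rw [Ψ.source_eq] at h1 ⊢
      exact rightAct_mem g h1
    have hinv : rightAct g⁻¹ (rightAct g a.src) = a.src := by
      rw [rightAct_rightAct, mul_inv_cancel, rightAct_one]
    refine ⟨Ψ, hs, by rw [Ψ.equivariant _ h1, h2], ?_⟩
    have hev : Ψ.toFun =ᶠ[nhds (rightAct g a.src)]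
        (fun X => rightAct g (Ψ.toFun (rightAct g⁻¹ X))) := by
      filter_upwards [Ψ.open_source.mem_nhds hs] with X hX
      rw [Ψ.equivariant X hX, rightAct_rightAct, inv_mul_cancel, rightAct_one]
    rw [hev.fderiv_eq, ← h3]
    have hd : HasFDerivAt Ψ.toFun (fderiv ℝ Ψ.toFun a.src) (rightAct g⁻¹ (rightAct g a.src)) := by
      rw [hinv]
      exact (Ψ.differentiableAt h1).hasFDerivAt
    exact ((rightAct g).hasFDerivAt.comp _ (hd.comp _ (rightAct g⁻¹).hasFDerivAt)).fderiv

theorem jetAt_act (Ψ : FrameIso) (X : FrameSpace) (hX : X ∈ Ψ.source) (g : GL3)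
    (hXg : rightAct g X ∈ Ψ.source) :
    (Ψ.jetAt X hX).act g = Ψ.jetAt (rightAct g X) hXg := by
  have hinv : rightAct g⁻¹ (rightAct g X) = X := by
    rw [rightAct_rightAct, mul_inv_cancel, rightAct_one]
  refine FrameJet.ext rfl (Ψ.equivariant X hX g).symm ?_
  have hev : Ψ.toFun =ᶠ[nhds (rightAct g X)]
      (fun X => rightAct g (Ψ.toFun (rightAct g⁻¹ X))) := by
    filter_upwards [Ψ.open_source.mem_nhds hXg] with X hX
    rw [Ψ.equivariant X hX, rightAct_rightAct, inv_mul_cancel, rightAct_one]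
  have hd : HasFDerivAt Ψ.toFun (fderiv ℝ Ψ.toFun X) (rightAct g⁻¹ (rightAct g X)) := by
    rw [hinv]
    exact (Ψ.differentiableAt hX).hasFDerivAt
  change _ = fderiv ℝ Ψ.toFun (rightAct g X)
  rw [hev.fderiv_eq]
  exact ((rightAct g).hasFDerivAt.comp _ (hd.comp _ (rightAct g⁻¹).hasFDerivAt)).fderiv.symm

theorem act_act (a : FrameJet) (g h : GL3) : (a.act g).act h = a.act (g * h) := by
  refine FrameJet.ext (rightAct_rightAct _ _ _) (rightAct_rightAct _ _ _) ?_
  refine ContinuousLinearMap.ext fun X => ?_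
  change rightAct h (rightAct g (a.lin (rightAct g⁻¹ (rightAct h⁻¹ X)))) =
    rightAct (g * h) (a.lin (rightAct (g * h)⁻¹ X))
  rw [rightAct_rightAct, rightAct_rightAct, mul_inv_rev]

theorem act_one (a : FrameJet) : a.act 1 = a := by
  refine FrameJet.ext (rightAct_one _) (rightAct_one _) ?_
  refine ContinuousLinearMap.ext fun X => ?_
  change rightAct 1 (a.lin (rightAct 1⁻¹ X)) = a.lin X
  rw [inv_one, rightAct_one, rightAct_one]

/-- Two jets are equivalent when they lie in one orbit of `Gl(3, ℝ)`. -/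
instance setoid : Setoid FrameJet where
  r a b := ∃ g : GL3, b = a.act g
  iseqv :=
    { refl := fun a => ⟨1, a.act_one.symm⟩
      symm := by
        rintro a b ⟨g, rfl⟩
        exact ⟨g⁻¹, by rw [act_act, mul_inv_cancel, act_one]⟩
      trans := by
        rintro a b c ⟨g, rfl⟩ ⟨h, rfl⟩
        exact ⟨g * h, a.act_act g h⟩ }

/-- The composite `j¹(Fτ_v) · j¹_{X,Y} Ψ = j¹(Fτ_v ∘ Ψ)`. -/
noncomputable def translate (v : E3) (a : FrameJet) : FrameJet :=
  ((FrameIso.translation v).jetAt a.tgt ⟨trivial, a.tgt_isUnit⟩).comp a rfl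

theorem translation_lin (v : E3) (X : FrameSpace) :
    fderiv ℝ (FrameIso.translation v).toFun X = ContinuousLinearMap.id ℝ FrameSpace := by
  have : (FrameIso.translation v).toFun = fun X : FrameSpace => X + ((v, 0) : FrameSpace) := by
    funext X
    change (X.1 + v, X.2) = _
    ext1 <;> simp
  rw [this, fderiv_add_const]
  exact fderiv_fun_id

theorem translate_act (v : E3) (a : FrameJet) (g : GL3) :
    (a.act g).translate v = (a.translate v).act g := by
  refine FrameJet.ext rfl rfl ?_
  change (fderiv ℝ (FrameIso.translation v).toFun _) ∘L (rightAct g ∘L a.lin ∘L rightAct g⁻¹) =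
    rightAct g ∘L ((fderiv ℝ (FrameIso.translation v).toFun _) ∘L a.lin) ∘L rightAct g⁻¹
  rw [translation_lin, translation_lin]
  rfl

/-- The representative, in the class of `a`, whose source is the frame `(x, 1)`. -/
noncomputable def normalize (a : FrameJet) : FrameJet := a.act (a.src_isUnit.unit)⁻¹

theorem normalize_act (a : FrameJet) (g : GL3) : (a.act g).normalize = a.normalize := by
  have : (a.act g).src_isUnit.unit = a.src_isUnit.unit * g := by
    ext1
    simp [act]
  rw [normalize, normalize, act_act, this, mul_inv_rev, mul_inv_cancel_left]

end FrameJet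

/-- The second-order non-holonomic groupoid `J̃¹(Fℝ³)` over `ℝ³`, the quotient of `J¹(Fℝ³)` by the
action of `Gl(3, ℝ)`. -/
def NHGroupoid : Type := Quotient FrameJet.setoid

/-- The class `j¹_{x,y} Ψ` of the jet `j¹_{X,Y} Ψ`. -/
def FrameJet.toNH (a : FrameJet) : NHGroupoid := Quotient.mk FrameJet.setoid a

namespace NHGroupoid

/-- The source map of `J̃¹(Fℝ³)`. -/
def source : NHGroupoid → E3 :=
  Quotient.lift (fun a : FrameJet => a.src.1) (by rintro a b ⟨g, rfl⟩; rfl)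

/-- The target map of `J̃¹(Fℝ³)`. -/
def target : NHGroupoid → E3 :=
  Quotient.lift (fun a : FrameJet => a.tgt.1) (by rintro a b ⟨g, rfl⟩; rfl)

/-- `J̃¹(FU, FV)`, the elements with source in `U` and target in `V`. -/
def between (U V : Set E3) : Set NHGroupoid := {q | q.source ∈ U ∧ q.target ∈ V}

/-- The map `j¹_{x,y} Ψ ↦ j¹_{x,y+v} (Fτ_v ∘ Ψ)`. -/
noncomputable def translate (v : E3) : NHGroupoid → NHGroupoid :=
  Quotient.lift (fun a : FrameJet => (a.translate v).toNH) (by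
    rintro a b ⟨g, rfl⟩
    exact Quotient.sound ⟨g, a.translate_act v g⟩)

theorem translate_source (v : E3) (q : NHGroupoid) : (q.translate v).source = q.source := by
  induction q using Quotient.inductionOn
  rfl

theorem translate_target (v : E3) (q : NHGroupoid) : (q.translate v).target = q.target + v := by
  induction q using Quotient.inductionOn
  rfl

theorem translate_mem {U V : Set E3} {q : NHGroupoid} (hq : q.source ∈ U) {z : E3} (hz : z ∈ V) :
    q.translate (z - q.target) ∈ between U V :=
  ⟨by rw [translate_source]; exact hq, by
    rw [translate_target, add_sub_cancel]; exact hz⟩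

/-- The global coordinates `(xⁱ, yʲ, yʲᵢ, yʲ_{,i}, yʲ_{i,k})` of `J̃¹(Fℝ³)`: source, target, frame
part of `Ψ(x, 1)`, and the derivatives at `(x, 1)` of the base part and of the frame part of `Ψ` in
the directions of the base. They make `J̃¹(Fℝ³)` a manifold. -/
noncomputable def coords :
    NHGroupoid → E3 × E3 × (E3 →L[ℝ] E3) × (E3 →L[ℝ] E3) × (E3 →L[ℝ] (E3 →L[ℝ] E3)) :=
  Quotient.lift
    (fun a : FrameJet => (a.normalize.src.1, a.normalize.tgt.1, a.normalize.tgt.2,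
      ContinuousLinearMap.fst ℝ E3 (E3 →L[ℝ] E3) ∘L a.normalize.lin ∘L
        ContinuousLinearMap.inl ℝ E3 (E3 →L[ℝ] E3),
      ContinuousLinearMap.snd ℝ E3 (E3 →L[ℝ] E3) ∘L a.normalize.lin ∘L
        ContinuousLinearMap.inl ℝ E3 (E3 →L[ℝ] E3)))
    (by
      rintro a b ⟨g, rfl⟩
      simp only [FrameJet.normalize_act])

end NHGroupoid

/-- A Cosserat continuum with mechanical response in `V`. The body is identified, through a
reference configuration, with a non-empty open subset `B` of `ℝ³`; the mechanical response is a
smooth function on `J̃¹(FB)` which does not depend on the end point. -/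
structure CosseratContinuum (V : Type*) [NormedAddCommGroup V] [NormedSpace ℝ V] where
  body : Set E3
  isOpen_body : IsOpen body
  nonempty_body : body.Nonempty
  W : NHGroupoid.between body body → V
  smooth_W : ∃ f : E3 × E3 × (E3 →L[ℝ] E3) × (E3 →L[ℝ] E3) × (E3 →L[ℝ] (E3 →L[ℝ] E3)) → V,
    ContDiffOn ℝ ∞ f (NHGroupoid.coords '' NHGroupoid.between body body) ∧
      ∀ q, W q = f (NHGroupoid.coords q)
  W_translate : ∀ (q : NHGroupoid.between body body) (z : E3) (hz : z ∈ body),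
    W q = W ⟨q.1.translate (z - q.1.target), NHGroupoid.translate_mem q.2.1 hz⟩

/-- The crystal references: `F̄²B` is the set of the 1-jets `j¹_{e₁,Z} Ψ` of local isomorphisms of
principal bundles `Ψ : Fℝ³ → FB` over the identity of `Gl(3, ℝ)`. -/
def nonholonomicFrames (B : Set E3) : Set FrameJet :=
  {Z | Z.src = stdFrame ∧ Z.tgt ∈ frameBundle B}

namespace FrameIso

theorem section_mem (κ : FrameIso) {x y : E3} (hx : x ∈ κ.dom) (hy : y ∈ κ.dom) :
    ((x, 1) : FrameSpace) ∈
      ((κ.trans (translation (κ.base y - κ.base x))).trans κ.symm).source := by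
  have h1 : ((x, 1) : FrameSpace) ∈ κ.source := by rw [κ.source_eq]; exact frame_mem hx
  have h2 := κ.map_source' h1
  rw [κ.target_eq] at h2
  refine ⟨⟨h1, trivial, h2.2⟩, ?_⟩
  change ((κ.toFun (x, 1)).1 + (κ.base y - κ.base x), (κ.toFun (x, 1)).2) ∈ κ.target
  rw [κ.target_eq]
  refine ⟨?_, h2.2⟩
  change κ.base x + (κ.base y - κ.base x) ∈ κ.cod
  rw [add_sub_cancel]
  exact κ.base_mem hy

/-- For `κ̃ : FU → Fℝ³` and `x, y ∈ U`, the element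
`j¹_{x,y} (κ̃⁻¹ ∘ Fτ_{κ(y) - κ(x)} ∘ κ̃)` of `J̃¹(FU)`. -/
noncomputable def groupoidSection (κ : FrameIso) (x y : E3) (hx : x ∈ κ.dom) (hy : y ∈ κ.dom) :
    NHGroupoid :=
  (((κ.trans (translation (κ.base y - κ.base x))).trans κ.symm).jetAt (x, 1)
    (κ.section_mem hx hy)).toNH

theorem reference_mem (κ : FrameIso) {x : E3} (hx : x ∈ κ.dom) :
    stdFrame ∈ ((translation (κ.base x)).trans κ.symm).source := by
  refine ⟨frame_mem trivial, ?_⟩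
  change ((0 : E3) + κ.base x, (1 : E3 →L[ℝ] E3)) ∈ κ.target
  rw [κ.target_eq, zero_add]
  exact frame_mem (κ.base_mem hx)

/-- For `κ̃ : FU → Fℝ³` and `x ∈ U`, the frame `j¹_{0,x} (κ̃⁻¹ ∘ Fτ_{κ(x)})` of `F̄²U`. -/
noncomputable def frameSection (κ : FrameIso) (x : E3) (hx : x ∈ κ.dom) : FrameJet :=
  ((translation (κ.base x)).trans κ.symm).jetAt stdFrame (κ.reference_mem hx)

end FrameIso

namespace CosseratContinuum

variable {V : Type*} [NormedAddCommGroup V] [NormedSpace ℝ V]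

/-- The mechanical response extended from `J̃¹(FB)` to `J̃¹(FB, Fℝ³)` by its independence of the
end point: the end point is moved into `B` (here, onto the source) by a translation. -/
noncomputable def response (C : CosseratContinuum V) (q : NHGroupoid) (hq : q.source ∈ C.body) :
    V :=
  C.W ⟨q.translate (q.source - q.target), NHGroupoid.translate_mem hq hq⟩

theorem mem_source (C : CosseratContinuum V) (a : FrameJet) (ha : a.tgt.1 ∈ C.body) (κ : FrameIso)
    (hκ : κ.dom = C.body) : a.tgt ∈ κ.source := by
  rw [κ.source_eq, hκ]
  exact ⟨ha, a.tgt_isUnit⟩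

/-- `W(j¹ κ̃ · j¹_{x,y} Ψ) = W(j¹ κ̃)` for all infinitesimal deformations `j¹_{y,κ(y)} κ̃`. A global
deformation `κ̃` is an embedding `FB → Fℝ³` of principal bundles over the identity of `Gl(3, ℝ)`,
that is, an isomorphism from `FB` onto the frame bundle of an open subset of `ℝ³`. -/
def IsMaterial (C : CosseratContinuum V) (a : FrameJet) (hs : a.src.1 ∈ C.body)
    (ht : a.tgt.1 ∈ C.body) : Prop :=
  ∀ (κ : FrameIso) (hκ : κ.dom = C.body),
    C.response ((κ.jetAt a.tgt (C.mem_source a ht κ hκ)).comp a rfl).toNH hs =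
      C.response (κ.jetAt a.tgt (C.mem_source a ht κ hκ)).toNH ht

/-- The second-order non-holonomic material groupoid `Ω̄(B) ⊆ J̃¹(FB)`. -/
def materialGroupoid (C : CosseratContinuum V) : Set NHGroupoid :=
  {q | ∃ (a : FrameJet) (hs : a.src.1 ∈ C.body) (ht : a.tgt.1 ∈ C.body),
    a.toNH = q ∧ C.IsMaterial a hs ht}

/-- The open set `U ⊆ B` is homogeneous: there is a deformation `κ̃` over `U` such that
`(x, y) ↦ j¹_{x,y} (κ̃⁻¹ ∘ Fτ_{κ(y) - κ(x)} ∘ κ̃)` is a section over `U × U` of `Ω̄(B)`. -/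
def HomogeneousOn (C : CosseratContinuum V) (U : Set E3) : Prop :=
  ∃ (κ : FrameIso) (hκ : κ.dom = U), ∀ (x y : E3) (hx : x ∈ U) (hy : y ∈ U),
    κ.groupoidSection x y (hκ ▸ hx) (hκ ▸ hy) ∈ C.materialGroupoid

/-- The Cosserat continuum is homogeneous. -/
def Homogeneous (C : CosseratContinuum V) : Prop := C.HomogeneousOn C.body

/-- The Cosserat continuum is locally homogeneous: it is covered by homogeneous open sets. -/
def LocallyHomogeneous (C : CosseratContinuum V) : Prop :=
  ∀ x ∈ C.body, ∃ U : Set E3, IsOpen U ∧ x ∈ U ∧ U ⊆ C.body ∧ C.HomogeneousOn U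

/-- The non-holonomic structure of second order `ω̄ = Ω̄_{z₀}(B) · Z̄₀ ⊆ F̄²B` defined by the crystal
reference `Z̄₀`; the element of `Ω̄_{z₀}(B)` is represented by a jet whose source is the target of
`Z̄₀`. -/
def crystalStructure (C : CosseratContinuum V) (Z : FrameJet) : Set FrameJet :=
  {P | ∃ (a : FrameJet) (h : Z.tgt = a.src), a.toNH ∈ C.materialGroupoid ∧ P = a.comp Z h}

/-- The open set `U ⊆ B` is homogeneous with respect to the crystal reference `Z̄₀`: there is a
deformation `κ̃` over `U` such that `x ↦ j¹_{0,x} (κ̃⁻¹ ∘ Fτ_{κ(x)})` is a uniform reference, i.e. a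
section over `U` of the structure defined by `Z̄₀`. -/
def HomogeneousOnWrt (C : CosseratContinuum V) (Z : FrameJet) (U : Set E3) : Prop :=
  ∃ (κ : FrameIso) (hκ : κ.dom = U), ∀ (x : E3) (hx : x ∈ U),
    κ.frameSection x (hκ ▸ hx) ∈ C.crystalStructure Z

/-- The Cosserat continuum is homogeneous with respect to the crystal reference `Z̄₀`. -/
def HomogeneousWrt (C : CosseratContinuum V) (Z : FrameJet) : Prop := C.HomogeneousOnWrt Z C.body

/-- The Cosserat continuum is locally homogeneous with respect to the crystal reference `Z̄₀`:
every point has an open neighbourhood which is homogeneous with respect to `Z̄₀`. -/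
def LocallyHomogeneousWrt (C : CosseratContinuum V) (Z : FrameJet) : Prop :=
  ∀ x ∈ C.body, ∃ U : Set E3, IsOpen U ∧ x ∈ U ∧ U ⊆ C.body ∧ C.HomogeneousOnWrt Z U

end CosseratContinuum

/-!
The proposition rests on two facts about the material groupoid `Ω̄(B)`.

First, the material jets are closed under composition and under `(c · a, a) ↦ c`
(`CosseratContinuum.comp_toNH_mem_iff`). The defining condition only tests jets of *global*
deformations, whereas the closure argument applies it to composites `j¹κ̃ · a`. The two agree because
every 1-jet over a point of an open set `U` is the jet of an isomorphism defined on all of `FU`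
(`FrameIso.exists_dom_eq`): the base map is extended affinely, and the frame part by
`x ↦ M₀ exp (M₀⁻¹ L (x - x₀))`, which is invertible everywhere. Hence `a` is material exactly when
`W(b · a) = W(b)` for every jet `b` (`CosseratContinuum.toNH_mem_materialGroupoid_iff`).

Second, for a deformation `κ̃` over `U`, the frames `s(x) = j¹(κ̃⁻¹ ∘ Fτ_{κ(x)})` satisfy
`s(y) = c · s(x)`, where `c` represents `j¹_{x,y}(κ̃⁻¹ ∘ Fτ_{κ(y) - κ(x)} ∘ κ̃)`
(`FrameIso.exists_comp_frameSection`). So if these groupoid elements are material, `Z̄₀ = s(x₀)` is a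
crystal reference with respect to which `U` is homogeneous; and if `s(x) = a · Z̄₀` and
`s(y) = b · Z̄₀` with `a`, `b` material, then `c · a = b`, so that `c` is material.

For the local statement, let `Z̄₀` be obtained in this way from one homogeneous open set. The set of
points near which `B` is homogeneous with respect to `Z̄₀` is open and non-empty. If it contains one
point of a homogeneous open set `U`, it contains all of `U`
(`CosseratContinuum.HomogeneousOn.mem_homogeneousPoints`): the local automorphisms
`κ̃⁻¹ ∘ Fτ_v ∘ κ̃` have material jets and carry a deformation adapted to `Z̄₀` from one point of `U` to
any other. As `B` is covered by homogeneous open sets, the set is also relatively closed in `B`, and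
so it is all of `B` when `B` is connected.
-/

/-! ### Extension of 1-jets to global deformations -/

namespace FrameIso

theorem mk_one_mem_source (Ψ : FrameIso) {x : E3} (hx : x ∈ Ψ.dom) :
    ((x, 1) : FrameSpace) ∈ Ψ.source := by
  rw [Ψ.source_eq]; exact frame_mem hx

theorem fst_mem_dom (Ψ : FrameIso) {X : FrameSpace} (hX : X ∈ Ψ.source) : X.1 ∈ Ψ.dom := by
  rw [Ψ.source_eq] at hX; exact hX.1

theorem base_symm_base (Ψ : FrameIso) {x : E3} (hx : x ∈ Ψ.dom) :
    Ψ.symm.base (Ψ.base x) = x := by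
  have h := Ψ.mk_one_mem_source hx
  have h2 := Ψ.symm.base_fst (X := Ψ.toFun (x, 1)) (Ψ.map_source' h)
  have h3 : Ψ.symm.toFun (Ψ.toFun (x, 1)) = (x, 1) := Ψ.left_inv' h
  rw [h3] at h2
  exact h2.symm

theorem base_base_symm (Ψ : FrameIso) {y : E3} (hy : y ∈ Ψ.cod) :
    Ψ.base (Ψ.symm.base y) = y :=
  Ψ.symm.base_symm_base hy

theorem differentiableAt_section (Ψ : FrameIso) {x : E3} (hx : x ∈ Ψ.dom) :
    DifferentiableAt ℝ (fun y : E3 => Ψ.toFun (y, 1)) x :=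
  (Ψ.differentiableAt (Ψ.mk_one_mem_source hx)).comp (f := fun y : E3 => ((y, 1) : FrameSpace)) x
    (by fun_prop)

theorem differentiableAt_base (Ψ : FrameIso) {x : E3} (hx : x ∈ Ψ.dom) :
    DifferentiableAt ℝ Ψ.base x :=
  (Ψ.differentiableAt_section hx).fst

theorem fderiv_base_symm_comp (Ψ : FrameIso) {x : E3} (hx : x ∈ Ψ.dom) :
    fderiv ℝ Ψ.symm.base (Ψ.base x) ∘L fderiv ℝ Ψ.base x = ContinuousLinearMap.id ℝ E3 := by
  rw [← fderiv_comp x (Ψ.symm.differentiableAt_base (Ψ.base_mem hx)) (Ψ.differentiableAt_base hx)]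
  have : Ψ.symm.base ∘ Ψ.base =ᶠ[nhds x] id := by
    filter_upwards [Ψ.isOpen_dom.mem_nhds hx] with y hy
    exact Ψ.base_symm_base hy
  rw [this.fderiv_eq, fderiv_id]

/-- The derivative of the base map, as a linear automorphism of `ℝ³`. -/
noncomputable def baseDeriv (Ψ : FrameIso) {x : E3} (hx : x ∈ Ψ.dom) : E3 ≃L[ℝ] E3 :=
  ContinuousLinearEquiv.equivOfInverse (fderiv ℝ Ψ.base x) (fderiv ℝ Ψ.symm.base (Ψ.base x))
    (fun v => DFunLike.congr_fun (Ψ.fderiv_base_symm_comp hx) v)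
    (fun v => by
      have h := Ψ.symm.fderiv_base_symm_comp (Ψ.base_mem hx)
      rw [Ψ.base_symm_base hx] at h
      exact DFunLike.congr_fun h v)

/-- By equivariance, the derivative of `Ψ` at a frame is determined by the value and the derivative
of `x ↦ Ψ (x, 1)` at its base point. -/
theorem hasFDerivAt_of_section (Ψ : FrameIso) {s : FrameSpace} (hs : s ∈ Ψ.source)
    {f' : E3 →L[ℝ] FrameSpace} (hf : HasFDerivAt (fun x : E3 => Ψ.toFun (x, 1)) f' s.1) :
    HasFDerivAt Ψ.toFun
      (fderiv ℝ (fun p : FrameSpace × FrameSpace => ((p.1.1, p.1.2 * p.2.2) : FrameSpace))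
          (Ψ.toFun (s.1, 1), s) ∘L
        (f' ∘L ContinuousLinearMap.fst ℝ E3 (E3 →L[ℝ] E3)).prod
          (ContinuousLinearMap.id ℝ FrameSpace)) s := by
  have hev : Ψ.toFun =ᶠ[nhds s]
      fun X => ((Ψ.toFun (X.1, 1)).1, (Ψ.toFun (X.1, 1)).2 * X.2) := by
    filter_upwards [Ψ.open_source.mem_nhds hs] with X hX
    have hX' := hX
    rw [Ψ.source_eq] at hX'
    obtain ⟨u, hu⟩ := hX'.2
    have h := Ψ.equivariant _ (Ψ.mk_one_mem_source (Ψ.fst_mem_dom hX)) u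
    rw [rightAct_frame u hu, rightAct_apply, hu] at h
    exact h
  refine HasFDerivAt.congr_of_eventuallyEq ?_ hev
  have h1 : HasFDerivAt (fun X : FrameSpace => Ψ.toFun (X.1, 1))
      (f' ∘L ContinuousLinearMap.fst ℝ E3 (E3 →L[ℝ] E3)) s :=
    HasFDerivAt.comp (g := fun x : E3 => Ψ.toFun (x, 1)) s hf hasFDerivAt_fst
  have h2 : DifferentiableAt ℝ
      (fun p : FrameSpace × FrameSpace => ((p.1.1, p.1.2 * p.2.2) : FrameSpace))
      (Ψ.toFun (s.1, 1), s) := by fun_prop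
  exact HasFDerivAt.comp
    (g := fun p : FrameSpace × FrameSpace => ((p.1.1, p.1.2 * p.2.2) : FrameSpace)) s
    (f := fun X : FrameSpace => (Ψ.toFun (X.1, 1), X)) h2.hasFDerivAt
    (h1.prodMk (hasFDerivAt_id s))

theorem fderiv_eq_of_section {Ψ Φ : FrameIso} {s : FrameSpace} (hs : s ∈ Ψ.source)
    (hs' : s ∈ Φ.source) {f' : E3 →L[ℝ] FrameSpace}
    (hf : HasFDerivAt (fun x : E3 => Ψ.toFun (x, 1)) f' s.1)
    (hg : HasFDerivAt (fun x : E3 => Φ.toFun (x, 1)) f' s.1)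
    (h : Ψ.toFun (s.1, 1) = Φ.toFun (s.1, 1)) :
    fderiv ℝ Ψ.toFun s = fderiv ℝ Φ.toFun s := by
  rw [(Ψ.hasFDerivAt_of_section hs hf).fderiv, (Φ.hasFDerivAt_of_section hs' hg).fderiv, h]

theorem isOpen_frameBundle {U : Set E3} (hU : IsOpen U) : IsOpen (frameBundle U) :=
  (hU.preimage continuous_fst).inter (Units.isOpen.preimage continuous_snd)

/-- The principal isomorphism `(x, z) ↦ (A x + c, M x ∘ z)` over an affine map, where `N x` is the
inverse of `M x`. -/
noncomputable def ofAffine (U : Set E3) (hU : IsOpen U) (A : E3 ≃L[ℝ] E3) (c : E3)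
    (M N : E3 → (E3 →L[ℝ] E3)) (hM : ContDiff ℝ ∞ M) (hN : ContDiff ℝ ∞ N)
    (hMN : ∀ x, M x * N x = 1) (hNM : ∀ x, N x * M x = 1) : FrameIso where
  toFun := fun X => (A X.1 + c, M X.1 * X.2)
  invFun := fun X => (A.symm (X.1 - c), N (A.symm (X.1 - c)) * X.2)
  source := frameBundle U
  target := frameBundle {y | A.symm (y - c) ∈ U}
  map_source' := fun X h => ⟨by simpa using h.1, (Units.mk _ _ (hMN X.1) (hNM X.1)).isUnit.mul h.2⟩
  map_target' := fun X h => ⟨h.1, (Units.mk _ _ (hNM _) (hMN _)).isUnit.mul h.2⟩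
  left_inv' := fun X _ => by simp [← mul_assoc, hNM]
  right_inv' := fun X _ => by simp [← mul_assoc, hMN]
  open_source := isOpen_frameBundle hU
  open_target := isOpen_frameBundle (hU.preimage (by fun_prop))
  continuousOn_toFun := by
    have := hM.continuous
    fun_prop
  continuousOn_invFun := by
    have := hN.continuous
    fun_prop
  dom := U
  cod := {y | A.symm (y - c) ∈ U}
  isOpen_dom := hU
  isOpen_cod := hU.preimage (by fun_prop)
  source_eq := rfl
  target_eq := rfl
  smooth_toFun := by
    refine ContDiff.contDiffOn (ContDiff.prodMk (by fun_prop) ?_)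
    exact (hM.comp contDiff_fst).mul contDiff_snd
  smooth_invFun := by
    refine ContDiff.contDiffOn (ContDiff.prodMk (by fun_prop) ?_)
    exact (hN.comp (by fun_prop)).mul contDiff_snd
  equivariant := fun X _ g => by simp [mul_assoc]

/-- A value in `Gl(3, ℝ)` and a derivative at a point are attained by a smooth map defined on all of
`ℝ³` with invertible values: `x ↦ M₀ exp (M₀⁻¹ L (x - x₀))`. -/
theorem exists_invertible_hasFDerivAt (M₀ : GL3) (L : E3 →L[ℝ] (E3 →L[ℝ] E3)) (x₀ : E3) :
    ∃ M N : E3 → (E3 →L[ℝ] E3), ContDiff ℝ ∞ M ∧ ContDiff ℝ ∞ N ∧ (∀ x, M x * N x = 1) ∧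
      (∀ x, N x * M x = 1) ∧ M x₀ = M₀ ∧ HasFDerivAt M L x₀ := by
  let ℓ : E3 →L[ℝ] (E3 →L[ℝ] E3) :=
    ContinuousLinearMap.compL ℝ E3 E3 E3 ((M₀⁻¹ : GL3) : E3 →L[ℝ] E3) ∘L L
  have hexp : ContDiff ℝ ∞ (NormedSpace.exp : (E3 →L[ℝ] E3) → (E3 →L[ℝ] E3)) :=
    contDiff_iff_contDiffAt.2 fun x => (NormedSpace.exp_analytic x).contDiffAt
  have hℓ : ContDiff ℝ ∞ fun x : E3 => ℓ (x - x₀) := by fun_prop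
  -- The functional equation of `NormedSpace.exp` is stated for algebras over `ℚ`.
  let _ : NormedAlgebra ℚ (E3 →L[ℝ] E3) := NormedAlgebra.restrictScalars ℚ ℝ (E3 →L[ℝ] E3)
  have hinv : ∀ a : E3 →L[ℝ] E3, NormedSpace.exp a * NormedSpace.exp (-a) = 1 := fun a => by
    rw [← NormedSpace.exp_add_of_commute (Commute.refl a).neg_right, add_neg_cancel,
      NormedSpace.exp_zero]
  have hmul : ∀ a : E3 →L[ℝ] E3, ContDiff ℝ ∞ fun b : E3 →L[ℝ] E3 => a * b := fun a =>
    (ContinuousLinearMap.compL ℝ E3 E3 E3 a).contDiff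
  have hmul' : ∀ a : E3 →L[ℝ] E3, ContDiff ℝ ∞ fun b : E3 →L[ℝ] E3 => b * a := fun a =>
    ((ContinuousLinearMap.compL ℝ E3 E3 E3).flip a).contDiff
  refine ⟨fun x => M₀ * NormedSpace.exp (ℓ (x - x₀)),
    fun x => NormedSpace.exp (-ℓ (x - x₀)) * ((M₀⁻¹ : GL3) : E3 →L[ℝ] E3),
    (hmul _).comp (hexp.comp hℓ), (hmul' _).comp (hexp.comp hℓ.neg), fun x => ?_, fun x => ?_,
    ?_, ?_⟩
  · rw [mul_assoc, ← mul_assoc (NormedSpace.exp _), hinv, one_mul, Units.mul_inv]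
  · rw [mul_assoc, Units.inv_mul_cancel_left]
    simpa using hinv (-ℓ (x - x₀))
  · simp only [sub_self, map_zero, NormedSpace.exp_zero, mul_one]
  · have h2 : HasFDerivAt (fun x : E3 => ℓ (x - x₀)) ℓ x₀ :=
      ℓ.hasFDerivAt.comp x₀ ((hasFDerivAt_id _).sub_const _)
    have h3 : HasFDerivAt (NormedSpace.exp : (E3 →L[ℝ] E3) → (E3 →L[ℝ] E3))
        (1 : (E3 →L[ℝ] E3) →L[ℝ] (E3 →L[ℝ] E3)) (ℓ (x₀ - x₀)) := by
      rw [sub_self, map_zero]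
      exact hasFDerivAt_exp_zero
    have h4 := (ContinuousLinearMap.compL ℝ E3 E3 E3 (M₀ : E3 →L[ℝ] E3)).hasFDerivAt.comp x₀
      (h3.comp x₀ h2)
    have he : ContinuousLinearMap.compL ℝ E3 E3 E3 (M₀ : E3 →L[ℝ] E3) ∘L
        ((1 : (E3 →L[ℝ] E3) →L[ℝ] (E3 →L[ℝ] E3)) ∘L ℓ) = L :=
      ContinuousLinearMap.ext fun v => Units.mul_inv_cancel_left M₀ (L v)
    rw [he] at h4
    exact h4

/-- Every 1-jet over a point of an open set `U` is the jet of an isomorphism defined on all of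
`FU`; its base map can be taken affine. -/
theorem exists_dom_eq (Ψ : FrameIso) {s : FrameSpace} (hs : s ∈ Ψ.source) {U : Set E3}
    (hU : IsOpen U) (hsU : s.1 ∈ U) :
    ∃ κ : FrameIso, κ.dom = U ∧ κ.toFun s = Ψ.toFun s ∧
      fderiv ℝ κ.toFun s = fderiv ℝ Ψ.toFun s := by
  have hx := Ψ.fst_mem_dom hs
  have hσ := (Ψ.differentiableAt_section hx).hasFDerivAt
  set f' := fderiv ℝ (fun y : E3 => Ψ.toFun (y, 1)) s.1
  have h1 := Ψ.map_source' (Ψ.mk_one_mem_source hx)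
  rw [Ψ.target_eq] at h1
  obtain ⟨M₀, hM₀⟩ := h1.2
  obtain ⟨M, N, hM, hN, hMN, hNM, hMx, hM'⟩ := exists_invertible_hasFDerivAt M₀
    (ContinuousLinearMap.snd ℝ E3 (E3 →L[ℝ] E3) ∘L f') s.1
  let κ := ofAffine U hU (Ψ.baseDeriv hx) (Ψ.base s.1 - Ψ.baseDeriv hx s.1) M N hM hN hMN hNM
  have hs' := hs
  rw [Ψ.source_eq] at hs'
  have hsκ : s ∈ κ.source := ⟨hsU, hs'.2⟩
  have hval : κ.toFun (s.1, 1) = Ψ.toFun (s.1, 1) := by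
    refine Prod.ext (add_sub_cancel _ _) ?_
    change M s.1 * 1 = _
    rw [mul_one, hMx, hM₀]
  refine ⟨κ, rfl, ?_, ?_⟩
  · obtain ⟨u, hu⟩ := hs'.2
    rw [← rightAct_frame u hu, κ.equivariant _ (κ.mk_one_mem_source hsU),
      Ψ.equivariant _ (Ψ.mk_one_mem_source hx), hval]
  · refine fderiv_eq_of_section hsκ hs (f' := f') ?_ hσ hval
    have hbase : HasFDerivAt Ψ.base (ContinuousLinearMap.fst ℝ E3 (E3 →L[ℝ] E3) ∘L f') s.1 :=
      hσ.fst
    have hb : ((Ψ.baseDeriv hx : E3 ≃L[ℝ] E3) : E3 →L[ℝ] E3) =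
        ContinuousLinearMap.fst ℝ E3 (E3 →L[ℝ] E3) ∘L f' := hbase.fderiv
    have k1 : HasFDerivAt (fun x : E3 => Ψ.baseDeriv hx x + (Ψ.base s.1 - Ψ.baseDeriv hx s.1))
        (ContinuousLinearMap.fst ℝ E3 (E3 →L[ℝ] E3) ∘L f') s.1 := by
      rw [← hb]
      exact (Ψ.baseDeriv hx).hasFDerivAt.add_const _
    have k2 : HasFDerivAt (fun x : E3 => M x * 1)
        (ContinuousLinearMap.snd ℝ E3 (E3 →L[ℝ] E3) ∘L f') s.1 := by
      simpa only [mul_one] using hM'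
    exact k1.prodMk k2

end FrameIso

/-! ### Composition of jets -/

namespace FrameJet

theorem exists_lin_rightInverse (a : FrameJet) :
    ∃ r : FrameSpace →L[ℝ] FrameSpace, a.lin ∘L r = ContinuousLinearMap.id ℝ FrameSpace := by
  obtain ⟨Ψ, h1, h2, h3⟩ := a.exists_rep
  have ht := Ψ.map_source' h1
  refine ⟨fderiv ℝ Ψ.symm.toFun (Ψ.toFun a.src), ?_⟩
  have hd : DifferentiableAt ℝ Ψ.toFun (Ψ.symm.toFun (Ψ.toFun a.src)) := by
    rw [show Ψ.symm.toFun (Ψ.toFun a.src) = a.src from Ψ.left_inv' h1]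
    exact Ψ.differentiableAt h1
  have hc := fderiv_comp (Ψ.toFun a.src) hd (Ψ.symm.differentiableAt ht)
  rw [show Ψ.symm.toFun (Ψ.toFun a.src) = a.src from Ψ.left_inv' h1, h3] at hc
  rw [← hc]
  have hev : Ψ.toFun ∘ Ψ.symm.toFun =ᶠ[nhds (Ψ.toFun a.src)] id := by
    filter_upwards [Ψ.open_target.mem_nhds ht] with Y hY
    exact Ψ.right_inv' hY
  rw [hev.fderiv_eq, fderiv_id]

/-- Jets, being invertible, can be cancelled on the right. -/
theorem comp_right_cancel {a b Z : FrameJet} (ha : Z.tgt = a.src) (hb : Z.tgt = b.src)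
    (h : a.comp Z ha = b.comp Z hb) : a = b := by
  refine FrameJet.ext (ha.symm.trans hb)
    (congrArg FrameJet.tgt h : (a.comp Z ha).tgt = (b.comp Z hb).tgt) ?_
  obtain ⟨r, hr⟩ := Z.exists_lin_rightInverse
  have h1 : a.lin ∘L Z.lin = b.lin ∘L Z.lin := congrArg FrameJet.lin h
  calc a.lin = (a.lin ∘L Z.lin) ∘L r := by
        rw [ContinuousLinearMap.comp_assoc, hr, ContinuousLinearMap.comp_id]
    _ = b.lin := by rw [h1, ContinuousLinearMap.comp_assoc, hr, ContinuousLinearMap.comp_id]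

theorem toNH_act (a : FrameJet) (g : GL3) : (a.act g).toNH = a.toNH :=
  (Quotient.sound (s := FrameJet.setoid) ⟨g, rfl⟩ : a.toNH = (a.act g).toNH).symm

theorem act_comp (b a : FrameJet) (h : a.tgt = b.src) (g : GL3) :
    (b.act g).comp (a.act g) (congrArg (rightAct g) h) = (b.comp a h).act g := by
  refine FrameJet.ext rfl rfl (ContinuousLinearMap.ext fun X => ?_)
  change rightAct g (b.lin (rightAct g⁻¹ (rightAct g (a.lin (rightAct g⁻¹ X))))) =
    rightAct g (b.lin (a.lin (rightAct g⁻¹ X)))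
  rw [rightAct_rightAct, mul_inv_cancel, rightAct_one]

/-- A jet over a point of an open set `U` is the jet of a deformation over `U`. -/
theorem exists_jetAt_eq (b : FrameJet) {U : Set E3} (hU : IsOpen U) (hb : b.src.1 ∈ U) :
    ∃ (κ : FrameIso) (_ : κ.dom = U) (h : b.src ∈ κ.source), κ.jetAt b.src h = b := by
  obtain ⟨Ψ, h1, h2, h3⟩ := b.exists_rep
  obtain ⟨κ, k1, k2, k3⟩ := Ψ.exists_dom_eq h1 hU hb
  refine ⟨κ, k1, ?_, FrameJet.ext rfl (k2.trans h2) (k3.trans h3)⟩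
  rw [κ.source_eq, k1]
  exact ⟨hb, b.src_isUnit⟩

end FrameJet

namespace FrameIso

theorem jetAt_trans (Ψ Φ : FrameIso) (X : FrameSpace) (hX : X ∈ (Ψ.trans Φ).source) :
    (Ψ.trans Φ).jetAt X hX = (Φ.jetAt (Ψ.toFun X) hX.2).comp (Ψ.jetAt X hX.1) rfl :=
  FrameJet.ext rfl rfl (fderiv_comp X (Φ.differentiableAt hX.2) (Ψ.differentiableAt hX.1))

theorem jetAt_congr (Ψ : FrameIso) {X Y : FrameSpace} (h : X = Y) (hX : X ∈ Ψ.source) :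
    Ψ.jetAt X hX = Ψ.jetAt Y (h ▸ hX) := by
  subst h; rfl

theorem toNH_jetAt_eq (Ψ : FrameIso) {X : FrameSpace} (hX : X ∈ Ψ.source)
    (h1 : ((X.1, 1) : FrameSpace) ∈ Ψ.source) :
    (Ψ.jetAt X hX).toNH = (Ψ.jetAt (X.1, 1) h1).toNH := by
  have hX' := hX
  rw [Ψ.source_eq] at hX'
  obtain ⟨u, hu⟩ := hX'.2
  rw [← FrameJet.toNH_act (Ψ.jetAt (X.1, 1) h1) u,
    FrameJet.jetAt_act _ _ _ _ (by rw [rightAct_frame u hu]; exact hX)]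
  rw [Ψ.jetAt_congr (rightAct_frame u hu)]

/-! ### The groupoid section and the frame section of a deformation -/

/-- The local automorphism `κ̃⁻¹ ∘ Fτ_{κ(y) - κ(x)} ∘ κ̃`. -/
noncomputable abbrev transport (κ : FrameIso) (x y : E3) : FrameIso :=
  (κ.trans (translation (κ.base y - κ.base x))).trans κ.symm

theorem transport_congr (κ : FrameIso) {x y x' y' : E3}
    (h : κ.base y - κ.base x = κ.base y' - κ.base x') : κ.transport x y = κ.transport x' y' := by
  rw [transport, h]

theorem base_transport (κ : FrameIso) (x y : E3) {w : E3} (hw : w ∈ (κ.transport x y).dom) :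
    w ∈ κ.dom ∧ (κ.transport x y).base w ∈ κ.dom ∧
      κ.base ((κ.transport x y).base w) = κ.base w + (κ.base y - κ.base x) := by
  have hs := (κ.transport x y).mk_one_mem_source hw
  have h2 : (translation (κ.base y - κ.base x)).toFun (κ.toFun (w, 1)) ∈ κ.target := hs.2
  have h3 := κ.symm.base_fst h2
  have h4 : (κ.transport x y).base w = κ.symm.base (κ.base w + (κ.base y - κ.base x)) := h3
  rw [κ.target_eq] at h2
  have h5 : κ.base w + (κ.base y - κ.base x) ∈ κ.cod := h2.1
  rw [h4]
  exact ⟨κ.fst_mem_dom hs.1.1, κ.symm.base_mem h5, κ.base_base_symm h5⟩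

theorem mem_dom_transport (κ : FrameIso) {x y : E3} (hx : x ∈ κ.dom) (hy : y ∈ κ.dom) :
    x ∈ (κ.transport x y).dom ∧ (κ.transport x y).base x = y := by
  have h := (κ.transport x y).fst_mem_dom (κ.section_mem hx hy)
  obtain ⟨-, h2, h3⟩ := κ.base_transport x y h
  refine ⟨h, ?_⟩
  rw [← κ.base_symm_base h2, h3, add_sub_cancel, κ.base_symm_base hy]

theorem frameSection_tgt_fst (κ : FrameIso) {x : E3} (hx : x ∈ κ.dom) :
    (κ.frameSection x hx).tgt.1 = x := by
  have h := κ.symm.base_fst (κ.reference_mem hx).2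
  have h2 : (κ.frameSection x hx).tgt.1 = κ.symm.base (0 + κ.base x) := h
  rw [h2, zero_add, κ.base_symm_base hx]

theorem frameSection_tgt_mem (κ : FrameIso) {x : E3} (hx : x ∈ κ.dom) :
    (κ.frameSection x hx).tgt ∈ frameBundle κ.dom := by
  refine ⟨?_, (κ.frameSection x hx).tgt_isUnit⟩
  rw [frameSection_tgt_fst]
  exact hx

/-- The frames `j¹(κ̃⁻¹ ∘ Fτ_{κ(x)})` at different points are related by the sections
`j¹(κ̃⁻¹ ∘ Fτ_{κ(y) - κ(x)} ∘ κ̃)`. -/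
theorem exists_comp_frameSection (κ : FrameIso) {x y : E3} (hx : x ∈ κ.dom) (hy : y ∈ κ.dom) :
    ∃ (c : FrameJet) (h : (κ.frameSection x hx).tgt = c.src),
      c.toNH = κ.groupoidSection x y hx hy ∧
        κ.frameSection y hy = c.comp (κ.frameSection x hx) h := by
  have hX1 := κ.frameSection_tgt_fst hx
  set X := (κ.frameSection x hx).tgt with hX
  have hXs : X ∈ (κ.transport x y).source := by
    rw [(κ.transport x y).source_eq]
    refine ⟨?_, (κ.frameSection x hx).tgt_isUnit⟩
    rw [hX1]
    exact (κ.mem_dom_transport hx hy).1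
  refine ⟨(κ.transport x y).jetAt X hXs, rfl, ?_, ?_⟩
  · have h1 : ((X.1, 1) : FrameSpace) ∈ (κ.transport x y).source := by
      rw [hX1]; exact κ.section_mem hx hy
    rw [(κ.transport x y).toNH_jetAt_eq hXs h1]
    have he : ((X.1, 1) : FrameSpace) = (x, 1) := by rw [hX1]
    rw [(κ.transport x y).jetAt_congr he]
    rfl
    -- Both sides are the jet at `e₁` of `κ̃⁻¹ ∘ Fτ_{κ(y)}`, since `κ̃ ∘ κ̃⁻¹` is the identity.
  · let Φ := ((translation (κ.base x)).trans κ.symm).trans (κ.transport x y)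
    have hΦ : stdFrame ∈ Φ.source := ⟨κ.reference_mem hx, hXs⟩
    have hj := jetAt_trans _ _ _ hΦ
    refine Eq.trans ?_ hj
    have hev : ((translation (κ.base y)).trans κ.symm).toFun =ᶠ[nhds stdFrame] Φ.toFun := by
      filter_upwards [Φ.open_source.mem_nhds hΦ] with Y hY
      have h1 : (translation (κ.base x)).toFun Y ∈ κ.target := hY.1.2
      have h2 : κ.toFun (κ.invFun ((translation (κ.base x)).toFun Y)) =
        (translation (κ.base x)).toFun Y := κ.right_inv' h1
      change κ.invFun ((translation (κ.base y)).toFun Y) =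
        κ.invFun ((translation (κ.base y - κ.base x)).toFun
          (κ.toFun (κ.invFun ((translation (κ.base x)).toFun Y))))
      rw [h2]
      congr 1
      change (Y.1 + κ.base y, Y.2) = (Y.1 + κ.base x + (κ.base y - κ.base x), Y.2)
      congr 1
      abel
    exact FrameJet.ext rfl hev.self_of_nhds hev.fderiv_eq

end FrameIso

/-! ### The material groupoid and homogeneity -/

namespace CosseratContinuum

variable {V : Type*} [NormedAddCommGroup V] [NormedSpace ℝ V]

theorem response_congr (C : CosseratContinuum V) {p q : NHGroupoid} (h : p = q)
    (hp : p.source ∈ C.body) : C.response p hp = C.response q (h ▸ hp) := by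
  subst h; rfl

/-- Since every jet over `B` is the jet of a global deformation, a jet is material exactly when
composition with it does not change the response at any jet. -/
theorem toNH_mem_materialGroupoid_iff (C : CosseratContinuum V) (a : FrameJet) :
    a.toNH ∈ C.materialGroupoid ↔ ∃ (hs : a.src.1 ∈ C.body) (ht : a.tgt.1 ∈ C.body),
      ∀ (b : FrameJet) (h : a.tgt = b.src),
        C.response (b.comp a h).toNH hs = C.response b.toNH (h ▸ ht : b.src.1 ∈ C.body) := by
  constructor
  · rintro ⟨a', hs, ht, haa', hm⟩
    obtain ⟨g, rfl⟩ : ∃ g : GL3, a = a'.act g := Quotient.exact (s := FrameJet.setoid) haa'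
    refine ⟨hs, ht, fun b h => ?_⟩
    have hb : a'.tgt = (b.act g⁻¹).src := by
      change a'.tgt = rightAct g⁻¹ b.src
      rw [← h]
      change a'.tgt = rightAct g⁻¹ (rightAct g a'.tgt)
      rw [rightAct_rightAct, mul_inv_cancel, rightAct_one]
    have hbg : (b.act g⁻¹).act g = b := by
      rw [FrameJet.act_act, inv_mul_cancel, FrameJet.act_one]
    obtain ⟨κ, hκ, hκs, hκb⟩ := (b.act g⁻¹).exists_jetAt_eq C.isOpen_body
      (show (b.act g⁻¹).src.1 ∈ C.body from hb ▸ ht)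
    have hκa : κ.jetAt a'.tgt (C.mem_source a' ht κ hκ) = b.act g⁻¹ := by
      rw [κ.jetAt_congr hb]; exact hκb
    have h1 : ((κ.jetAt a'.tgt (C.mem_source a' ht κ hκ)).comp a' rfl).toNH =
        (b.comp (a'.act g) h).toNH := by
      rw [← FrameJet.toNH_act ((κ.jetAt a'.tgt (C.mem_source a' ht κ hκ)).comp a' rfl) g]
      refine congrArg FrameJet.toNH (Eq.trans (FrameJet.act_comp _ a' rfl g).symm ?_)
      refine FrameJet.ext rfl ?_ ?_
      · change ((κ.jetAt a'.tgt _).act g).tgt = b.tgt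
        rw [hκa, hbg]
      · change ((κ.jetAt a'.tgt _).act g).lin ∘L (a'.act g).lin = b.lin ∘L (a'.act g).lin
        rw [hκa, hbg]
    have h2 : (κ.jetAt a'.tgt (C.mem_source a' ht κ hκ)).toNH = b.toNH := by
      rw [hκa, FrameJet.toNH_act]
    rw [← C.response_congr h1 hs, ← C.response_congr h2 ht]
    exact hm κ hκ
  · rintro ⟨hs, ht, h⟩
    exact ⟨a, hs, ht, rfl, fun κ hκ => h _ rfl⟩

/-- A jet `c` composable with a material jet `a` is material exactly when `c · a` is: this
expresses that the material jets are closed under composition and contain `c = (c · a) · a⁻¹`. -/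
theorem comp_toNH_mem_iff (C : CosseratContinuum V) {a c : FrameJet} (h : a.tgt = c.src)
    (ha : a.toNH ∈ C.materialGroupoid) :
    (c.comp a h).toNH ∈ C.materialGroupoid ↔ c.toNH ∈ C.materialGroupoid := by
  rw [toNH_mem_materialGroupoid_iff] at ha ⊢
  rw [toNH_mem_materialGroupoid_iff]
  obtain ⟨hs, ht, hW⟩ := ha
  constructor
  · rintro ⟨ks, kt, k⟩
    exact ⟨h ▸ ht, kt, fun d hd => (hW (d.comp c hd) h).symm.trans (k d hd)⟩
  · rintro ⟨ks, kt, k⟩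
    exact ⟨hs, kt, fun d hd => (hW (d.comp c hd) h).trans (k d hd)⟩

theorem comp_mem_crystalStructure (C : CosseratContinuum V) {Z P c : FrameJet}
    (hP : P ∈ C.crystalStructure Z) (h : P.tgt = c.src) (hc : c.toNH ∈ C.materialGroupoid) :
    c.comp P h ∈ C.crystalStructure Z := by
  obtain ⟨a, ha, ham, rfl⟩ := hP
  exact ⟨c.comp a h, ha, (C.comp_toNH_mem_iff (a := a) h ham).2 hc, rfl⟩

theorem HomogeneousOnWrt.homogeneousOn {C : CosseratContinuum V} {Z : FrameJet} {U : Set E3}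
    (h : C.HomogeneousOnWrt Z U) : C.HomogeneousOn U := by
  obtain ⟨κ, rfl, hκ⟩ := h
  refine ⟨κ, rfl, fun x y hx hy => ?_⟩
  obtain ⟨c, hc, hcs, hcomp⟩ := κ.exists_comp_frameSection hx hy
  obtain ⟨a, ha, ham, hax⟩ := hκ x hx
  obtain ⟨b, hb, hbm, hby⟩ := hκ y hy
  have hac : a.tgt = c.src := (congrArg FrameJet.tgt hax).symm.trans hc
  -- From `b · Z = c · (a · Z)` it follows that `c · a = b`.
  have hcab : c.comp a hac = b := by
    refine FrameJet.comp_right_cancel (Z := Z) ha hb ?_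
    rw [← hby, hcomp]
    refine FrameJet.ext ?_ rfl ?_
    · exact (congrArg FrameJet.src hax).symm
    · exact congrArg (c.lin ∘L ·) (congrArg FrameJet.lin hax).symm
  change κ.groupoidSection x y hx hy ∈ _
  rw [← hcs, ← C.comp_toNH_mem_iff hac ham, hcab]
  exact hbm

/-- On a homogeneous set, the frame `j¹(κ̃⁻¹ ∘ Fτ_{κ(x₀)})` at any point `x₀` serves as crystal
reference. -/
theorem HomogeneousOn.exists_wrt {C : CosseratContinuum V} {U : Set E3}
    (h : C.HomogeneousOn U) (hU : U ⊆ C.body) {x₀ : E3} (hx₀ : x₀ ∈ U) :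
    ∃ Z ∈ nonholonomicFrames C.body, C.HomogeneousOnWrt Z U := by
  obtain ⟨κ, rfl, hκ⟩ := h
  have ht := κ.frameSection_tgt_mem hx₀
  refine ⟨κ.frameSection x₀ hx₀, ⟨rfl, hU ht.1, ht.2⟩, κ, rfl, fun x hx => ?_⟩
  obtain ⟨c, hc, hcs, hcomp⟩ := κ.exists_comp_frameSection hx₀ hx
  refine ⟨c, hc, ?_, hcomp⟩
  rw [hcs]
  exact hκ x₀ x hx₀ hx

/-- The points near which the continuum is homogeneous with respect to `Z`. -/
def homogeneousPoints (C : CosseratContinuum V) (Z : FrameJet) : Set E3 :=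
  {x | ∃ U : Set E3, IsOpen U ∧ x ∈ U ∧ U ⊆ C.body ∧ C.HomogeneousOnWrt Z U}

theorem isOpen_homogeneousPoints (C : CosseratContinuum V) (Z : FrameJet) :
    IsOpen (C.homogeneousPoints Z) := by
  rw [isOpen_iff_mem_nhds]
  rintro x ⟨U, hU, hx, hUB, h⟩
  filter_upwards [hU.mem_nhds hx] with y hy
  exact ⟨U, hU, hy, hUB, h⟩

/-- Within a homogeneous set `U` with deformation `κ̃`, homogeneity with respect to `Z` near `x`
spreads to every `y`: if `λ̃` is a deformation near `x`, then `λ̃ ∘ Φ⁻¹` is one near `y`, where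
`Φ = κ̃⁻¹ ∘ Fτ_{κ(y) - κ(x)} ∘ κ̃` has only material jets. -/
theorem HomogeneousOn.mem_homogeneousPoints {C : CosseratContinuum V} {Z : FrameJet} {U : Set E3}
    (h : C.HomogeneousOn U) (hU : U ⊆ C.body) {x y : E3} (hx : x ∈ U) (hy : y ∈ U)
    (hxZ : x ∈ C.homogeneousPoints Z) : y ∈ C.homogeneousPoints Z := by
  obtain ⟨κ, rfl, hκ⟩ := h
  obtain ⟨U', -, hxU', -, l, rfl, hl⟩ := hxZ
  let Φ := κ.transport x y
  obtain ⟨hxΦ, hΦx⟩ := κ.mem_dom_transport hx hy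
  let μ := Φ.symm.trans l
  have hyc : y ∈ Φ.cod := hΦx ▸ Φ.base_mem hxΦ
  have hyx : Φ.symm.base y = x := by rw [← hΦx]; exact Φ.base_symm_base hxΦ
  refine ⟨μ.dom, μ.isOpen_dom, ⟨hyc, ?_⟩, ?_, μ, rfl, ?_⟩
  · rw [hyx]
    exact hxU'
  · rintro w ⟨hw, -⟩
    have h1 := (κ.base_transport x y (w := Φ.symm.base w) (Φ.symm.base_mem hw)).2.1
    rw [Φ.base_base_symm hw] at h1
    exact hU h1
  · intro w hw
    obtain ⟨hwc, hwl⟩ := hw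
    set w' := Φ.symm.base w with hw'
    have hwd : w' ∈ Φ.dom := Φ.symm.base_mem hwc
    have hΦw : Φ.base w' = w := Φ.base_base_symm hwc
    obtain ⟨hw'κ, hwκ, hκw⟩ := κ.base_transport x y hwd
    rw [hΦw] at hwκ hκw
    have hΦ : κ.transport w' w = Φ := κ.transport_congr (by rw [hκw]; abel)
    have hX1 := l.frameSection_tgt_fst hwl
    set X := (l.frameSection w' hwl).tgt with hX
    have hXs : X ∈ Φ.source := by
      rw [Φ.source_eq]
      refine ⟨?_, (l.frameSection w' hwl).tgt_isUnit⟩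
      rw [hX1]
      exact hwd
    have hμ : μ.base w = l.base w' := by
      have hs := μ.mk_one_mem_source (x := w) ⟨hwc, hwl⟩
      exact l.base_fst hs.2
    have hmat : (Φ.jetAt X hXs).toNH ∈ C.materialGroupoid := by
      have h1 : ((X.1, 1) : FrameSpace) ∈ Φ.source := by
        rw [hX1]; exact Φ.mk_one_mem_source hwd
      have he : ((X.1, 1) : FrameSpace) = (w', 1) := by rw [hX1]
      rw [Φ.toNH_jetAt_eq hXs h1, Φ.jetAt_congr he]
      have h2 := hκ w' w hw'κ hwκ
      have h3 : ∀ (Ψ : FrameIso) (_ : Ψ = Φ) (hΨ : ((w', 1) : FrameSpace) ∈ Ψ.source),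
          (Ψ.jetAt (w', 1) hΨ).toNH ∈ C.materialGroupoid →
            (Φ.jetAt (w', 1) (Φ.mk_one_mem_source hwd)).toNH ∈ C.materialGroupoid := by
        rintro _ rfl _ h
        exact h
      exact h3 _ hΦ _ h2
    have hmem := C.comp_mem_crystalStructure (hl w' hwl) (c := Φ.jetAt X hXs) rfl hmat
    have hsec : μ.frameSection w ⟨hwc, hwl⟩ = (Φ.jetAt X hXs).comp (l.frameSection w' hwl) rfl := by
      have hj := FrameIso.jetAt_trans ((FrameIso.translation (l.base w')).trans l.symm) Φ stdFrame
        ⟨l.reference_mem hwl, hXs⟩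
      refine Eq.trans ?_ hj
      refine FrameJet.ext rfl ?_ ?_
      · change Φ.toFun (l.invFun ((FrameIso.translation (μ.base w)).toFun stdFrame)) = _
        rw [hμ]
        rfl
      · change fderiv ℝ (fun Y => Φ.toFun (l.invFun ((FrameIso.translation (μ.base w)).toFun Y)))
          stdFrame = _
        rw [hμ]
        rfl
    rw [hsec]
    exact hmem

theorem LocallyHomogeneous.exists_wrt {C : CosseratContinuum V} (h : C.LocallyHomogeneous)
    (hB : IsConnected C.body) :
    ∃ Z ∈ nonholonomicFrames C.body, C.LocallyHomogeneousWrt Z := by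
  obtain ⟨x₀, hx₀⟩ := hB.nonempty
  obtain ⟨U₀, hU₀, hxU₀, hUB₀, hom₀⟩ := h x₀ hx₀
  obtain ⟨Z, hZ, hwrt⟩ := hom₀.exists_wrt hUB₀ hxU₀
  refine ⟨Z, hZ, ?_⟩
  change C.body ⊆ C.homogeneousPoints Z
  -- Around a point of `B` which is not in `homogeneousPoints Z`, a whole homogeneous neighbourhood
  -- avoids this set, so `B` would be disconnected.
  let T : Set E3 := ⋃₀ {U | IsOpen U ∧ U ⊆ C.body ∧ C.HomogeneousOn U ∧
    Disjoint U (C.homogeneousPoints Z)}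
  have hT : IsOpen T := isOpen_sUnion fun U hU => hU.1
  have hcov : C.body ⊆ C.homogeneousPoints Z ∪ T := by
    intro x hx
    by_cases hxZ : x ∈ C.homogeneousPoints Z
    · exact Or.inl hxZ
    · obtain ⟨U, hU, hxU, hUB, hom⟩ := h x hx
      refine Or.inr ⟨U, ⟨hU, hUB, hom, Set.disjoint_left.2 fun y hy hyZ => ?_⟩, hxU⟩
      exact hxZ (hom.mem_homogeneousPoints hUB hy hxU hyZ)
  have hdisj : Disjoint (C.homogeneousPoints Z) T :=
    Set.disjoint_sUnion_right.2 fun U hU => hU.2.2.2.symm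
  exact hB.isPreconnected.subset_left_of_subset_union (C.isOpen_homogeneousPoints Z) hT hdisj hcov
    ⟨x₀, hx₀, U₀, hU₀, hxU₀, hUB₀, hwrt⟩

theorem LocallyHomogeneousWrt.locallyHomogeneous {C : CosseratContinuum V} {Z : FrameJet}
    (h : C.LocallyHomogeneousWrt Z) : C.LocallyHomogeneous := fun x hx =>
  let ⟨U, hU, hxU, hUB, hom⟩ := h x hx
  ⟨U, hU, hxU, hUB, hom.homogeneousOn⟩

end CosseratContinuum

theorem mainTheorem2 {V : Type*} [NormedAddCommGroup V] [NormedSpace ℝ V]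
    (C : CosseratContinuum V) :
    (C.Homogeneous ↔ ∃ Z ∈ nonholonomicFrames C.body, C.HomogeneousWrt Z) ∧
    (IsConnected C.body →
      (C.LocallyHomogeneous ↔ ∃ Z ∈ nonholonomicFrames C.body, C.LocallyHomogeneousWrt Z)) ∧
    ((∃ Z ∈ nonholonomicFrames C.body, C.LocallyHomogeneousWrt Z) → C.LocallyHomogeneous) := by
  refine ⟨⟨fun h => ?_, fun ⟨_, _, h⟩ => h.homogeneousOn⟩,
    fun hB => ⟨fun h => h.exists_wrt hB, fun ⟨_, _, h⟩ => h.locallyHomogeneous⟩,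
    fun ⟨_, _, h⟩ => h.locallyHomogeneous⟩
  obtain ⟨x₀, hx₀⟩ := C.nonempty_body
  exact CosseratContinuum.HomogeneousOn.exists_wrt h subset_rfl hx₀
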